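/- **Notation.** $[n]=\{1,\dots,n\}$ and $\mathfrak S_n$ is its symmetric group. $B_n$ is the group of signed permutations, i.e. permutations $w$ of $\{\pm1,\dots,\pm n\}$ with $w(-i)=-w(i)$. For $w\in B_n$, an index $i\in[n]$ is a weak excedance if $w(i)=i$ or $w(|w(i)|)>w(i)$; $\mathrm{wexc}(w)$ is the number of weak excedances, and $\mathrm{cyc}(w)$ is the number of cycles of the permutation $i\mapsto|w(i)|$ of $[n]$ (fixed points count as cycles). For $\pi\in\mathfrak S_n$, $\mathrm{cyc}(\pi)$ is the number of cycles of $\pi$ and $\mathrm{cpk}(\pi)$ is the number of $i$ with $\pi^{-1}(i)<i>\pi(i)$. A polynomial $f(x)=\sum_{i=0}^n f_ix^i$ with $f_i=f_{n-i}$ for all $i$ is $\gamma$-positive if $f(x)=\sum_{i=0}^{\lfloor n/2\rfloor}\gamma_i x^i(1+x)^{n-2i}$ with all $\gamma_i\ge 0$. The numbers $b(n,i,j)$ ($n\ge1$; $i,j\in\mathbb Z$) are defined by $b(1,0,0)=1$, $b(1,i,j)=0$ for $(i,j)\ne(0,0)$, and $$b(n+1,i,j)=b(n,i,j)+2i\,b(n,i,j-1)+(n-2i+2)\,b(n,i-1,j-1)\qquad(n\ge1).$$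 Put $b_0(x,q)=1$ and $b_n(x,q)=\sum_{i=0}^{\lfloor n/2\rfloor}\sum_{j=i}^{n-1}b(n,i,j)x^iq^j$ for $n\ge1$. **Theorem 1.** Let $k$ be a nonzero real number. There is a unique sequence of polynomials $B_n^{(k)}(x)$ ($n\ge0$) with real coefficients such that $$\sum_{n\ge0}B_n^{(k)}(x)\frac{z^n}{n!}=\left(\frac{(1-x)e^{kz(1-x)}}{1-xe^{2kz(1-x)}}\right)^{1/k}$$ (for every complex $x\ne1$ and all $z$ near $0$, with the principal power). These polynomials satisfy $$B_n^{(k)}(x)=\sum_{w\in B_n}x^{\mathrm{wexc}(w)}k^{n-\mathrm{cyc}(w)}\qquad(n\ge0),$$ $$B_{n+1}^{(k)}(x)=(1+x+2knx)B_n^{(k)}(x)+2kx(1-x)\frac{d}{dx}B_n^{(k)}(x)\qquad(n\ge0),$$ with $B_0^{(k)}(x)=1$ and $B_1^{(k)}(x)=1+x$, and for $n\ge1$ $$B_n^{(k)}(x)=\sum_{i=0}^{\lfloor n/2\rfloor}\Big(\sum_{j=i}^{n-1}b(n,i,j)k^j4^i\Big)x^i(1+x)^{n-2i}.$$ If $k>0$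 and $n\ge1$, then $B_n^{(k)}(x)$ is $\gamma$-positive, i.e. it is symmetric and the numbers $\sum_{j=i}^{n-1}b(n,i,j)k^j4^i$ ($0\le i\le\lfloor n/2\rfloor$) are nonnegative. Moreover, for all $n\ge0$, $$b_n(x,q)=\sum_{\pi\in\mathfrak S_n}x^{\mathrm{cpk}(\pi)}q^{n-\mathrm{cyc}(\pi)},$$ and, for all complex $x\ne1$ and $q\ne0$, either choice of the square root, and all $z$ near $0$ (with the principal power), $$\sum_{n\ge0}b_n(x,q)\frac{z^n}{n!}=\left(\frac{\sqrt{1-x}}{\sqrt{1-x}\cosh(qz\sqrt{1-x})-\sinh(qz\sqrt{1-x})}\right)^{1/q}.$$ -/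

import Mathlib

open Polynomial Topology

namespace TypeB

/-- The set `±[n] = {±1, …, ±n}`: the pair `(i, ε)` with `i : Fin n` and `ε = ±1` stands for the
integer `ε * (i + 1)`, so that `i : Fin n` stands for the element `i + 1` of `[n]`. -/
abbrev SignedIndex (n : ℕ) : Type := Fin n × ℤˣ

/-- The integer `ε * (i + 1)` represented by `(i, ε)`. -/
def SignedIndex.val {n : ℕ} (a : SignedIndex n) : ℤ := (a.2 : ℤ) * ((a.1 : ℤ) + 1)

/-- Negation `a ↦ -a` on `±[n]`. -/
def SignedIndex.neg {n : ℕ} (a : SignedIndex n) : SignedIndex n := (a.1, -a.2)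

/-- The hyperoctahedral group `B_n`: the permutations `w` of `±[n]` with `w (-a) = -w a`. -/
abbrev SignedPerm (n : ℕ) : Type :=
  {w : Equiv.Perm (SignedIndex n) // ∀ a, w a.neg = (w a).neg}

/-- The letter `w(i)` for `i ∈ [n]`, an element of `±[n]`. -/
def SignedPerm.letter {n : ℕ} (w : SignedPerm n) (i : Fin n) : SignedIndex n := w.1 (i, 1)

theorem SignedPerm.fst_apply {n : ℕ} (w : SignedPerm n) (i : Fin n) (ε : ℤˣ) :
    (w.1 (i, ε)).1 = (w.1 (i, 1)).1 := by
  rcases Int.units_eq_one_or ε with h | h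
  · rw [h]
  · have h1 := w.2 (i, 1)
    simp only [SignedIndex.neg] at h1
    rw [h, h1]

theorem SignedPerm.fst_symm_apply {n : ℕ} (w : SignedPerm n) (i : Fin n) (ε : ℤˣ) :
    (w.1.symm (i, ε)).1 = (w.1.symm (i, 1)).1 := by
  have h2 : ∀ a, w.1.symm a.neg = (w.1.symm a).neg := by
    intro a
    rw [Equiv.symm_apply_eq, w.2, Equiv.apply_symm_apply]
  exact SignedPerm.fst_apply ⟨w.1.symm, h2⟩ i ε

/-- The permutation `i ↦ |w(i)|` of `[n]`. -/
def SignedPerm.abs {n : ℕ} (w : SignedPerm n) : Equiv.Perm (Fin n) where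
  toFun i := (w.letter i).1
  invFun i := (w.1.symm (i, 1)).1
  left_inv i := by
    have h := w.fst_symm_apply (w.letter i).1 (w.letter i).2
    simp only [SignedPerm.letter, Prod.mk.eta, Equiv.symm_apply_apply] at h
    exact h.symm
  right_inv i := by
    have h := w.fst_apply (w.1.symm (i, 1)).1 (w.1.symm (i, 1)).2
    simp only [Prod.mk.eta, Equiv.apply_symm_apply] at h
    exact h.symm

/-- The number of cycles of a permutation of `[n]`, fixed points included. -/
def cyc {n : ℕ} (π : Equiv.Perm (Fin n)) : ℕ := Multiset.card π.partition.parts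

/-- The number of cycles in the standard cycle decomposition of a signed permutation `w`. There
every element of `[n]` appears in exactly one cycle and carries a sign, e.g. `w = (-1)(3 -2)`;
the cycles are those of `|w|`, decorated with signs. -/
def SignedPerm.cyc {n : ℕ} (w : SignedPerm n) : ℕ := TypeB.cyc w.abs

/-- `i ∈ [n]` is a weak excedance of `w` if `w(i) = i` or `w(|w(i)|) > w(i)`. -/
def SignedPerm.IsWeakExc {n : ℕ} (w : SignedPerm n) (i : Fin n) : Prop :=
  w.letter i = (i, 1) ∨ (w.letter (w.letter i).1).val > (w.letter i).val

instance {n : ℕ} (w : SignedPerm n) (i : Fin n) : Decidable (w.IsWeakExc i) :=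
  inferInstanceAs (Decidable (_ ∨ _))

/-- The number of weak excedances of `w`. -/
def SignedPerm.wexc {n : ℕ} (w : SignedPerm n) : ℕ :=
  (Finset.univ.filter fun i : Fin n => w.IsWeakExc i).card

/-- The number of cycle peaks of `π`: indices `i` with `π⁻¹(i) < i > π(i)`. -/
def cpk {n : ℕ} (π : Equiv.Perm (Fin n)) : ℕ :=
  (Finset.univ.filter fun i : Fin n => π.symm i < i ∧ i > π i).card

/-- `B` is the sequence of polynomials with exponential generating function
`∑ B n (x) z ^ n / n! = ((1 - x) e ^ (k z (1 - x)) / (1 - x e ^ (2 k z (1 - x)))) ^ (1 / k)`.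
The base of the power is `1` at `z = 0`, and the power is the principal one, so that the right side
is holomorphic in `z` near `0` for every complex `x ≠ 1`. -/
def IsEulerianB (k : ℝ) (B : ℕ → ℝ[X]) : Prop :=
  ∀ x : ℂ, x ≠ 1 → ∀ᶠ z : ℂ in 𝓝 0,
    HasSum (fun n : ℕ => aeval x (B n) * z ^ n / (n.factorial : ℂ))
      (((1 - x) * Complex.exp (k * z * (1 - x)) /
        (1 - x * Complex.exp (2 * k * z * (1 - x)))) ^ (1 / (k : ℂ)))

/-- `f = ∑_{i ≤ n} f_i x ^ i` is symmetric (`f_i = f_{n-i}`), and the coefficients of its expansion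
in the polynomials `x ^ i (1 + x) ^ (n - 2 i)`, `0 ≤ i ≤ ⌊n / 2⌋`, are nonnegative. -/
def IsGammaPositive (n : ℕ) (f : ℝ[X]) : Prop :=
  f.natDegree ≤ n ∧ (∀ i ≤ n, f.coeff i = f.coeff (n - i)) ∧
    ∃ γ : ℕ → ℝ, (∀ i ≤ n / 2, 0 ≤ γ i) ∧
      f = ∑ i ∈ Finset.range (n / 2 + 1), C (γ i) * X ^ i * (1 + X) ^ (n - 2 * i)

/-- The numbers `b(n, i, j)`, for `n ≥ 1` and all integers `i`, `j`: `b(1, 0, 0) = 1`,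
`b(1, i, j) = 0` for `(i, j) ≠ (0, 0)`, and
`b(n+1, i, j) = b(n, i, j) + 2 i b(n, i, j-1) + (n - 2 i + 2) b(n, i-1, j-1)` for `n ≥ 1`.
(The value at `n = 0` is never used.) -/
def b : ℕ → ℤ → ℤ → ℤ
  | 0, _, _ => 0
  | 1, i, j => if i = 0 ∧ j = 0 then 1 else 0
  | n + 2, i, j =>
      b (n + 1) i j + 2 * i * b (n + 1) i (j - 1)
        + (((n + 1 : ℕ) : ℤ) - 2 * i + 2) * b (n + 1) (i - 1) (j - 1)

/-- The polynomial `b_n(x, q) = ∑_{i=0}^{⌊n/2⌋} ∑_{j=i}^{n-1} b(n, i, j) x ^ i q ^ j` for `n ≥ 1`,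
and `b_0(x, q) = 1`, in the variables `x = X 0` and `q = X 1`. -/
noncomputable def bPoly (n : ℕ) : MvPolynomial (Fin 2) ℤ :=
  if n = 0 then 1 else
    ∑ i ∈ Finset.range (n / 2 + 1), ∑ j ∈ Finset.Icc i (n - 1),
      MvPolynomial.C (b n i j) * MvPolynomial.X 0 ^ i * MvPolynomial.X 1 ^ j

end TypeB

/-! Everything reduces to one insertion argument in $\mathfrak S_n$. A new smallest element put into
the cycles of $e\in\mathfrak S_n$ either forms a fixed point, or lands in one of $n$ gaps; exactly
$2\,\mathrm{cpk}(e)$ gaps touch a cycle valley and keep `cpk`, the others raise it by one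
(`sum_perm_succ`). This is the recurrence of `b`, so `b n i j` counts permutations and is
nonnegative.

Signs are then summed out over each fixed $|w|=\pi$: the weak excedance condition reads a single
sign, so the sum is a product over $[n]$, equal to $(4x)^{\mathrm{cpk}}(1+x)^{n-2\mathrm{cpk}}$
(`sum_pow_wexc_signedOf`). Grouping by `cpk` gives the $\gamma$-expansion, and the insertion rule
gives the differential recurrence.

For the generating functions, the closed form $F$ and auxiliary functions $r,u$ satisfy a
first-order system under which differentiating in $z$ reproduces the recurrence, so
$F^{(n)}(0)=P_n(u(0))$ (`hasSum_of_derivatives`). Uniqueness is that of Taylor coefficients, then of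
polynomials agreeing at infinitely many points. -/

namespace TypeB

/-! ### Counting cycles. -/

section CycleStatistics

open Equiv Equiv.Perm

theorem cyc_eq_card_quotient {n : ℕ} (π : Perm (Fin n)) :
    cyc π = Nat.card (Quotient (SameCycle.setoid π)) := by
  classical
  have hne : ∀ c : {c // c ∈ π.cycleFactorsFinset}, ∃ x, c.1 x ≠ x := fun c =>
    let ⟨x, hx, _⟩ := (mem_cycleFactorsFinset_iff.1 c.2).1
    ⟨x, hx⟩
  choose r hr using hne
  have hcyc : ∀ c, π.cycleOf (r c) = c.1 := fun c =>
    (cycle_is_cycleOf (mem_support.2 (hr c)) c.2).symm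
  have hmov : ∀ c, π (r c) ≠ r c := fun c h => hr c <| by
    rw [← hcyc c, cycleOf_apply_self, h]
  let φ : {c // c ∈ π.cycleFactorsFinset} ⊕ {x // x ∉ π.support} →
      Quotient (SameCycle.setoid π) :=
    Sum.elim (fun c => Quotient.mk _ (r c)) (fun x => Quotient.mk _ x.1)
  have hφ : Function.Bijective φ := by
    constructor
    · rintro (c | x) (d | y) h
      · have h' : SameCycle π (r c) (r d) := Quotient.exact h
        congr 1
        apply Subtype.ext
        rw [← hcyc c, ← hcyc d, h'.cycleOf_eq]
      · have h' : SameCycle π (r c) y.1 := Quotient.exact h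
        exact absurd (h'.apply_eq_self_iff.2 (notMem_support.1 y.2)) (hmov c)
      · have h' : SameCycle π x.1 (r d) := Quotient.exact h
        exact absurd (h'.apply_eq_self_iff.1 (notMem_support.1 x.2)) (hmov d)
      · have h' : SameCycle π x.1 y.1 := Quotient.exact h
        congr 1
        apply Subtype.ext
        exact h'.eq_of_left (notMem_support.1 x.2)
    · intro q
      induction q using Quotient.inductionOn with
      | _ x =>
        by_cases hx : x ∈ π.support
        · refine ⟨Sum.inl ⟨π.cycleOf x, cycleOf_mem_cycleFactorsFinset_iff.2 hx⟩, ?_⟩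
          refine Quotient.sound ?_
          change SameCycle π _ x
          rw [sameCycle_comm, sameCycle_iff_cycleOf_eq_of_mem_support hx
            (mem_support.2 (hmov _)), hcyc]
        · exact ⟨Sum.inr ⟨x, hx⟩, rfl⟩
  rw [← Nat.card_eq_of_bijective φ hφ, Nat.card_sum, cyc, parts_partition, Multiset.card_add,
    Multiset.card_replicate, cycleType, Multiset.card_map]
  rw [Nat.card_eq_fintype_card, Nat.card_eq_fintype_card, Fintype.card_subtype_compl,
    Fintype.card_coe, Fintype.card_coe]
  rfl

/-- An invariant two-colouring is a free choice of colour on each cycle. Such colourings are easy to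
transport through an insertion, which avoids handling the cycle decomposition itself. -/
theorem two_pow_cyc {n : ℕ} (π : Perm (Fin n)) :
    2 ^ cyc π = Nat.card {f : Fin n → Bool // ∀ x, f (π x) = f x} := by
  have key : ∀ f : Fin n → Bool, (∀ x, f (π x) = f x) → ∀ x y, SameCycle π x y → f x = f y := by
    rintro f hf x _ ⟨i, rfl⟩
    induction i with
    | zero => rfl
    | succ i ih => rw [add_comm, zpow_add, zpow_one, mul_apply, hf, ih]
    | pred i ih =>
      rw [ih, sub_eq_add_neg, add_comm, zpow_add, mul_apply, zpow_neg_one, ← hf (π⁻¹ _)]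
      simp
  let E : {f : Fin n → Bool // ∀ x, f (π x) = f x} ≃ (Quotient (SameCycle.setoid π) → Bool) :=
    { toFun := fun f => Quotient.lift f.1 (key f.1 f.2)
      invFun := fun g => ⟨fun x => g (Quotient.mk _ x), fun x => congrArg g <| Quotient.sound <| by
        change SameCycle π _ _
        exact sameCycle_apply_left.2 (SameCycle.refl π x)⟩
      left_inv := fun f => rfl
      right_inv := fun g => by
        funext q
        induction q using Quotient.inductionOn with
        | _ x => rfl }
  rw [Nat.card_congr E, Nat.card_fun, ← cyc_eq_card_quotient]
  simp

/-- `decomposeFin.symm (p, e)` shifts `e` up by one and adds the element `0`: as a fixed point if `p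
= 0`, and between `e.symm j` and `j` in their cycle if `p = j.succ`. -/
theorem cyc_decomposeFin_symm_zero {n : ℕ} (e : Perm (Fin n)) :
    cyc (decomposeFin.symm (0, e)) = cyc e + 1 := by
  let E : {f : Fin (n + 1) → Bool // ∀ x, f (decomposeFin.symm (0, e) x) = f x} ≃
      Bool × {f : Fin n → Bool // ∀ x, f (e x) = f x} :=
    { toFun := fun f => (f.1 0, ⟨fun i => f.1 i.succ, fun i => by simpa using f.2 i.succ⟩)
      invFun := fun g => ⟨Fin.cons g.1 g.2.1, Fin.cases (by simp) fun i => by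
        simpa using g.2.2 i⟩
      left_inv := fun f => Subtype.ext <| by
        funext x
        cases x using Fin.cases <;> rfl
      right_inv := fun g => rfl }
  apply Nat.pow_right_injective le_rfl
  simp only
  rw [two_pow_cyc, Nat.card_congr E, Nat.card_prod, pow_succ, two_pow_cyc]
  simp [mul_comm]

theorem cyc_decomposeFin_symm_succ {n : ℕ} (j : Fin n) (e : Perm (Fin n)) :
    cyc (decomposeFin.symm (j.succ, e)) = cyc e := by
  have key : ∀ (f : Fin (n + 1) → Bool), f 0 = f j.succ → ∀ y, f (swap 0 j.succ y) = f y := by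
    intro f hf y
    rw [swap_apply_def]
    split_ifs with h1 h2
    · rw [h1, hf]
    · rw [h2, hf]
    · rfl
  let E : {f : Fin (n + 1) → Bool // ∀ x, f (decomposeFin.symm (j.succ, e) x) = f x} ≃
      {f : Fin n → Bool // ∀ x, f (e x) = f x} :=
    { toFun := fun f => ⟨fun i => f.1 i.succ, fun i => by
        have h0 := f.2 0
        have hi := f.2 i.succ
        rw [decomposeFin_symm_apply_zero] at h0
        rw [decomposeFin_symm_apply_succ, key _ h0.symm] at hi
        exact hi⟩
      invFun := fun g => ⟨Fin.cons (g.1 j) g.1, Fin.cases (by simp) fun i => by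
        rw [decomposeFin_symm_apply_succ, key (Fin.cons (g.1 j) g.1) (by simp)]
        simpa using g.2 i⟩
      left_inv := fun f => Subtype.ext <| by
        funext x
        cases x using Fin.cases with
        | zero =>
          have h0 := f.2 0
          rw [decomposeFin_symm_apply_zero] at h0
          exact h0
        | succ i => rfl
      right_inv := fun g => rfl }
  apply Nat.pow_right_injective le_rfl
  simp only
  rw [two_pow_cyc, Nat.card_congr E, two_pow_cyc]

theorem cyc_le {n : ℕ} (π : Perm (Fin n)) : cyc π ≤ n := by
  induction n with
  | zero =>
    have : cyc π = 0 := by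
      rw [cyc_eq_card_quotient]
      exact Nat.card_of_isEmpty
    omega
  | succ n ih =>
    obtain ⟨⟨p, e⟩, rfl⟩ := decomposeFin.symm.surjective π
    have := ih e
    cases p using Fin.cases with
    | zero => rw [cyc_decomposeFin_symm_zero]; omega
    | succ j => rw [cyc_decomposeFin_symm_succ]; omega

/-! ### Cycle peaks, cycle valleys and insertion of a smallest element. -/

/-- `i` is a cycle valley of `π`: `π⁻¹(i) > i < π(i)`. -/
def IsValley {n : ℕ} (π : Perm (Fin n)) (i : Fin n) : Prop := i < π.symm i ∧ i < π i

instance {n : ℕ} (π : Perm (Fin n)) : DecidablePred (IsValley π) :=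
  fun _ => inferInstanceAs (Decidable (_ ∧ _))

/-- Along the cycles there are as many ascents leaving an element as ascents entering one.
Discarding the elements with both leaves valleys on one side and peaks on the other. Valleys are the
handier statistic, since a new minimum can only create a valley at itself. -/
theorem cpk_eq_card_valleys {n : ℕ} (π : Perm (Fin n)) :
    cpk π = (Finset.univ.filter (IsValley π)).card := by
  have h : (Finset.univ.filter fun i => i < π i).card
      = (Finset.univ.filter fun i => π.symm i < i).card := by
    refine Finset.card_bij (fun i _ => π i) ?_ ?_ ?_
    · simp
    · simp
    · intro j hj
      exact ⟨π.symm j, by simpa using hj, by simp⟩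
  rw [← Finset.card_filter_add_card_filter_not (s := Finset.univ.filter fun i => i < π i)
      (fun i => π.symm i < i),
    ← Finset.card_filter_add_card_filter_not (s := Finset.univ.filter fun i => π.symm i < i)
      (fun i => i < π i), Finset.filter_filter, Finset.filter_filter, Finset.filter_filter,
    Finset.filter_filter] at h
  have h1 : (Finset.univ.filter fun i => i < π i ∧ π.symm i < i)
      = Finset.univ.filter fun i => π.symm i < i ∧ i < π i := by
    ext; simp [and_comm]
  have hfix : ∀ i, π.symm i = i ↔ π i = i := fun i => by
    rw [symm_apply_eq, eq_comm]
  have h2 : (Finset.univ.filter fun i => i < π i ∧ ¬ π.symm i < i)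
      = Finset.univ.filter (IsValley π) := by
    ext i
    have := hfix i
    simp only [Finset.mem_filter, Finset.mem_univ, true_and, IsValley]
    grind
  have h3 : (Finset.univ.filter fun i => π.symm i < i ∧ ¬ i < π i)
      = Finset.univ.filter fun i => π.symm i < i ∧ i > π i := by
    ext i
    have := hfix i
    simp only [Finset.mem_filter, Finset.mem_univ, true_and]
    grind
  rw [h1, h2, h3] at h
  unfold cpk
  omega

theorem two_mul_cpk_le {n : ℕ} (π : Perm (Fin n)) : 2 * cpk π ≤ n := by
  have hd : Disjoint (Finset.univ.filter fun i : Fin n => π.symm i < i ∧ i > π i)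
      (Finset.univ.filter (IsValley π)) := by
    rw [Finset.disjoint_filter]
    rintro i - ⟨h, -⟩ ⟨h', -⟩
    exact lt_asymm h h'
  have h := (Finset.card_union_of_disjoint hd).symm.trans_le (Finset.card_le_univ _)
  rw [← cpk_eq_card_valleys, Fintype.card_fin] at h
  change cpk π + cpk π ≤ n at h
  omega

theorem decomposeFin_symm_zero_symm_succ {n : ℕ} (e : Perm (Fin n)) (i : Fin n) :
    (decomposeFin.symm (0, e)).symm i.succ = (e.symm i).succ := by
  rw [symm_apply_eq]
  simp

theorem cpk_decomposeFin_symm_zero {n : ℕ} (e : Perm (Fin n)) :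
    cpk (decomposeFin.symm (0, e)) = cpk e := by
  rw [cpk_eq_card_valleys, cpk_eq_card_valleys, Fin.univ_succ, Finset.filter_cons_of_neg,
    Finset.filter_map, Finset.card_map]
  · congr 1
    ext i
    simp [IsValley, decomposeFin_symm_zero_symm_succ]
  · simp [IsValley]

theorem isValley_decomposeFin_symm_succ_zero {n : ℕ} (j : Fin n) (e : Perm (Fin n)) :
    IsValley (decomposeFin.symm (j.succ, e)) 0 := by
  constructor
  · rw [Fin.pos_iff_ne_zero, Ne, symm_apply_eq]
    simp [eq_comm]
  · simp

theorem isValley_decomposeFin_symm_succ_succ {n : ℕ} (j : Fin n) (e : Perm (Fin n)) (i : Fin n) :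
    IsValley (decomposeFin.symm (j.succ, e)) i.succ ↔ IsValley e i ∧ i ≠ j ∧ e i ≠ j := by
  have h1 : decomposeFin.symm (j.succ, e) i.succ = if e i = j then 0 else (e i).succ := by
    rw [decomposeFin_symm_apply_succ, swap_apply_def]
    simp
  have h2 : (decomposeFin.symm (j.succ, e)).symm i.succ
      = if i = j then 0 else (e.symm i).succ := by
    rw [symm_apply_eq]
    split_ifs with h
    · simp [h]
    · simp [swap_apply_def, h]
  rw [IsValley, h1, h2, IsValley]
  by_cases h : i = j <;> by_cases h' : e i = j <;> simp [h, h']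

/-- The element `0` is a new valley, and its neighbours `e.symm j` and `j` cease to be valleys.
Being adjacent in a cycle, they cannot both have been valleys. -/
theorem cpk_decomposeFin_symm_succ {n : ℕ} (j : Fin n) (e : Perm (Fin n)) :
    cpk (decomposeFin.symm (j.succ, e)) =
      if IsValley e j ∨ IsValley e (e.symm j) then cpk e else cpk e + 1 := by
  have h : cpk (decomposeFin.symm (j.succ, e)) =
      (((Finset.univ.filter (IsValley e)).erase j).erase (e.symm j)).card + 1 := by
    rw [cpk_eq_card_valleys, Fin.univ_succ, Finset.filter_cons_of_pos _ _ _ _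
      (isValley_decomposeFin_symm_succ_zero j e), Finset.card_cons, Finset.filter_map,
      Finset.card_map]
    congr 2
    ext i
    simp [isValley_decomposeFin_symm_succ_succ, eq_symm_apply]
    tauto
  rw [h]
  by_cases h1 : IsValley e j
  · have h2 : ¬ IsValley e (e.symm j) := fun h2 => by
      have := h2.2
      rw [apply_symm_apply] at this
      exact lt_asymm this h1.1
    rw [Finset.erase_eq_of_notMem (by simp [h2]), Finset.card_erase_add_one (by simp [h1]),
      if_pos (Or.inl h1), cpk_eq_card_valleys]
  · rw [Finset.erase_eq_of_notMem (a := j) (by simp [h1])]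
    by_cases h2 : IsValley e (e.symm j)
    · rw [Finset.card_erase_add_one (by simp [h2]), if_pos (Or.inr h2), cpk_eq_card_valleys]
    · rw [Finset.erase_eq_of_notMem (by simp [h2]), if_neg (by tauto), cpk_eq_card_valleys]

theorem card_valley_or_valley_symm {n : ℕ} (e : Perm (Fin n)) :
    (Finset.univ.filter fun j => IsValley e j ∨ IsValley e (e.symm j)).card = 2 * cpk e := by
  rw [Finset.filter_or, Finset.card_union_of_disjoint]
  · rw [← cpk_eq_card_valleys, two_mul]
    congr 1
    rw [cpk_eq_card_valleys]
    refine (Finset.card_bij (fun i _ => e i) ?_ ?_ ?_).symm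
    · simp
    · simp
    · intro j hj
      exact ⟨e.symm j, by simpa using hj, by simp⟩
  · rw [Finset.disjoint_filter]
    rintro j - h1 h2
    have := h2.2
    rw [apply_symm_apply] at this
    exact lt_asymm this h1.1

/-- Inserting a new smallest element into the cycles of the permutations of `[n]`. -/
theorem sum_perm_succ {M : Type*} [AddCommMonoid M] (F : ℕ → ℕ → M) (n : ℕ) :
    ∑ π : Perm (Fin (n + 1)), F (cpk π) (n + 1 - cyc π) =
      ∑ e : Perm (Fin n), (F (cpk e) (n - cyc e) + ((2 * cpk e) • F (cpk e) (n - cyc e + 1)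
        + (n - 2 * cpk e) • F (cpk e + 1) (n - cyc e + 1))) := by
  rw [← decomposeFin.symm.sum_comp, Fintype.sum_prod_type_right]
  refine Finset.sum_congr rfl fun e _ => ?_
  have hc := cyc_le e
  rw [Fin.sum_univ_succ, cpk_decomposeFin_symm_zero, cyc_decomposeFin_symm_zero,
    Nat.add_sub_add_right]
  congr 1
  have : ∀ j : Fin n, F (cpk (decomposeFin.symm (j.succ, e)))
      (n + 1 - cyc (decomposeFin.symm (j.succ, e))) =
      if IsValley e j ∨ IsValley e (e.symm j) then F (cpk e) (n - cyc e + 1)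
        else F (cpk e + 1) (n - cyc e + 1) := by
    intro j
    rw [cpk_decomposeFin_symm_succ, cyc_decomposeFin_symm_succ, Nat.sub_add_comm hc]
    split_ifs <;> rfl
  rw [Finset.sum_congr rfl fun j _ => this j, Finset.sum_ite, Finset.sum_const,
    Finset.sum_const, card_valley_or_valley_symm, Finset.filter_not,
    Finset.card_sdiff_of_subset (Finset.filter_subset _ _), card_valley_or_valley_symm,
    Finset.card_univ, Fintype.card_fin]

theorem cpk_add_cyc_le {n : ℕ} (π : Perm (Fin n)) : cpk π + cyc π ≤ n := by
  induction n with
  | zero =>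
    have := cyc_le π
    have := two_mul_cpk_le π
    omega
  | succ n ih =>
    obtain ⟨⟨p, e⟩, rfl⟩ := decomposeFin.symm.surjective π
    have := ih e
    cases p using Fin.cases with
    | zero => rw [cyc_decomposeFin_symm_zero, cpk_decomposeFin_symm_zero]; omega
    | succ j =>
      rw [cyc_decomposeFin_symm_succ, cpk_decomposeFin_symm_succ]
      split_ifs <;> omega

theorem cyc_pos {n : ℕ} (hn : 1 ≤ n) (π : Perm (Fin n)) : 0 < cyc π := by
  rw [cyc_eq_card_quotient]
  have : Nonempty (Quotient (SameCycle.setoid π)) := ⟨Quotient.mk _ ⟨0, hn⟩⟩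
  exact Nat.card_pos

theorem cpk_of_fin_zero (π : Perm (Fin 0)) : cpk π = 0 := by
  have := two_mul_cpk_le π
  omega

/-! ### The numbers `b` as counts of permutations. -/

theorem b_eq_sum (n : ℕ) (i j : ℤ) :
    b (n + 1) i j = ∑ π : Perm (Fin (n + 1)),
      if (cpk π : ℤ) = i ∧ ((n + 1 - cyc π : ℕ) : ℤ) = j then 1 else 0 := by
  induction n generalizing i j with
  | zero =>
    rw [sum_perm_succ (fun c m => if (c : ℤ) = i ∧ (m : ℤ) = j then (1 : ℤ) else 0)]
    simp [Finset.univ_unique, cpk_of_fin_zero, b, eq_comm]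
  | succ n ih =>
    rw [sum_perm_succ (fun c m => if (c : ℤ) = i ∧ (m : ℤ) = j then (1 : ℤ) else 0), b, ih, ih,
      ih, Finset.mul_sum, Finset.mul_sum, ← Finset.sum_add_distrib, ← Finset.sum_add_distrib]
    refine Finset.sum_congr rfl fun π _ => ?_
    have h := two_mul_cpk_le π
    rw [add_assoc]
    congr 1
    -- On the support of each indicator the multiplicity is the coefficient in the recurrence: `cpk
    -- π = i` gives $2i$, and `cpk π = i - 1` turns $n+1-2\,\mathrm{cpk}$ into $(n+1)-2i+2$.
    simp only [nsmul_eq_mul, Nat.cast_mul, Nat.cast_sub h, Nat.cast_add, Nat.cast_one,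
      Nat.cast_ofNat, ← eq_sub_iff_add_eq, mul_ite, mul_one, mul_zero]
    grind

/-- The recurrence has negative coefficients for some `i`, so the sign is read off the count. -/
theorem b_nonneg (n : ℕ) (i j : ℤ) : 0 ≤ b n i j := by
  cases n with
  | zero => exact le_rfl
  | succ n =>
    rw [b_eq_sum]
    exact Finset.sum_nonneg fun π _ => by split_ifs <;> simp

theorem sum_perm_eq_sum_b {M : Type*} [AddCommGroup M] (F : ℕ → ℕ → M) {n : ℕ} (hn : 1 ≤ n) :
    ∑ π : Perm (Fin n), F (cpk π) (n - cyc π) =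
      ∑ i ∈ Finset.range (n / 2 + 1), ∑ j ∈ Finset.Icc i (n - 1), b n i j • F i j := by
  obtain ⟨n, rfl⟩ := Nat.exists_eq_add_of_le' hn
  simp_rw [b_eq_sum, Finset.sum_smul]
  rw [Finset.sum_congr rfl fun i _ => Finset.sum_comm, Finset.sum_comm]
  refine Finset.sum_congr rfl fun π _ => ?_
  have h1 := two_mul_cpk_le π
  have h2 := cpk_add_cyc_le π
  have h3 := cyc_pos hn π
  rw [Finset.sum_eq_single (cpk π), Finset.sum_eq_single (n + 1 - cyc π)]
  · simp
  · intro j _ hj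
    rw [if_neg, zero_smul]
    exact fun h => hj (by exact_mod_cast h.2.symm)
  · intro h
    rw [Finset.mem_Icc] at h
    omega
  · intro i _ hi
    refine Finset.sum_eq_zero fun j _ => ?_
    rw [if_neg, zero_smul]
    exact fun h => hi (by exact_mod_cast h.1.symm)
  · intro h
    rw [Finset.mem_range] at h
    omega

theorem bPoly_eq_sum (n : ℕ) :
    bPoly n = ∑ π : Perm (Fin n),
      MvPolynomial.X 0 ^ cpk π * MvPolynomial.X 1 ^ (n - cyc π) := by
  rcases Nat.eq_zero_or_pos n with rfl | hn
  · simp [bPoly, Finset.univ_unique, cpk_of_fin_zero]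
  · rw [sum_perm_eq_sum_b (fun i j => (MvPolynomial.X 0 ^ i * MvPolynomial.X 1 ^ j :
      MvPolynomial (Fin 2) ℤ)) hn, bPoly, if_neg hn.ne']
    refine Finset.sum_congr rfl fun i _ => Finset.sum_congr rfl fun j _ => ?_
    rw [mul_assoc, MvPolynomial.smul_eq_C_mul]

/-! ### Summing over the signs. -/

/-- The signed permutation `w` with `|w| = π` in which the letter of absolute value `i` has the
sign `ε i`. -/
def signedOf {n : ℕ} (π : Perm (Fin n)) (ε : Fin n → ℤˣ) : SignedPerm n :=
  ⟨{ toFun := fun a => (π a.1, a.2 * ε (π a.1))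
     invFun := fun a => (π.symm a.1, a.2 * ε a.1)
     left_inv := fun a => by simp [mul_assoc]
     right_inv := fun a => by simp [mul_assoc] },
    fun a => by simp [SignedIndex.neg]⟩

theorem letter_signedOf {n : ℕ} (π : Perm (Fin n)) (ε : Fin n → ℤˣ) (i : Fin n) :
    (signedOf π ε).letter i = (π i, ε (π i)) := by
  simp [SignedPerm.letter, signedOf]

theorem abs_signedOf {n : ℕ} (π : Perm (Fin n)) (ε : Fin n → ℤˣ) : (signedOf π ε).abs = π := by
  ext i
  change (((signedOf π ε).letter i).1 : ℕ) = _
  rw [letter_signedOf]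

theorem letter_injective {n : ℕ} {v w : SignedPerm n} (h : ∀ i, v.letter i = w.letter i) :
    v = w := by
  apply Subtype.ext
  ext1 ⟨i, ε⟩
  have hi : v.1 (i, 1) = w.1 (i, 1) := h i
  rcases Int.units_eq_one_or ε with rfl | rfl
  · exact hi
  · have hv := v.2 (i, 1)
    have hw := w.2 (i, 1)
    simp only [SignedIndex.neg] at hv hw
    rw [hv, hw, hi]

/-- A signed permutation is an unsigned permutation with a choice of signs. -/
def signedPermEquiv (n : ℕ) : Perm (Fin n) × (Fin n → ℤˣ) ≃ SignedPerm n where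
  toFun p := signedOf p.1 p.2
  invFun w := (w.abs, fun i => (w.letter (w.abs.symm i)).2)
  left_inv p := by
    ext1
    · exact abs_signedOf _ _
    · funext i
      simp [abs_signedOf, letter_signedOf]
  right_inv w := letter_injective fun i => by
    rw [letter_signedOf]
    change (w.abs i, (w.letter (w.abs.symm (w.abs i))).2) = _
    rw [symm_apply_apply]
    rfl

theorem val_lt_val_of_fst_lt {n : ℕ} {a c : SignedIndex n} (h : a.1 < c.1) :
    a.val < c.val ↔ c.2 = 1 := by
  obtain ⟨i, ε⟩ := a
  obtain ⟨j, δ⟩ := c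
  have h' : (i : ℕ) < j := h
  rcases Int.units_eq_one_or ε with rfl | rfl <;> rcases Int.units_eq_one_or δ with rfl | rfl <;>
    simp [SignedIndex.val] <;> omega

theorem val_lt_val_of_lt_fst {n : ℕ} {a c : SignedIndex n} (h : c.1 < a.1) :
    a.val < c.val ↔ a.2 = -1 := by
  obtain ⟨i, ε⟩ := a
  obtain ⟨j, δ⟩ := c
  have h' : (j : ℕ) < i := h
  rcases Int.units_eq_one_or ε with rfl | rfl <;> rcases Int.units_eq_one_or δ with rfl | rfl <;>
    simp [SignedIndex.val] <;> omega

/-- Two letters of different absolute values are compared by the sign of the larger one alone; equal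
absolute values occur only at a fixed point of `π`. -/
theorem isWeakExc_signedOf {n : ℕ} (π : Perm (Fin n)) (ε : Fin n → ℤˣ) (i : Fin n) :
    (signedOf π ε).IsWeakExc i ↔
      if π (π i) < π i then ε (π i) = -1 else ε (π (π i)) = 1 := by
  rw [SignedPerm.IsWeakExc, letter_signedOf, letter_signedOf, gt_iff_lt]
  have hinj : π (π i) = π i ↔ π i = i := π.injective.eq_iff
  rcases lt_trichotomy (π (π i)) (π i) with h | h | h
  · rw [if_pos h, val_lt_val_of_lt_fst h]
    have : π i ≠ i := fun h' => h.ne (hinj.2 h')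
    simp [this]
  · rw [if_neg h.not_lt]
    simp [hinj.1 h]
  · rw [if_neg h.not_gt, val_lt_val_of_fst_lt h]
    have : π i ≠ i := fun h' => h.ne' (hinj.2 h')
    simp [this]

theorem pow_wexc_signedOf {R : Type*} [CommSemiring R] (x : R) {n : ℕ} (π : Perm (Fin n))
    (ε : Fin n → ℤˣ) :
    x ^ (signedOf π ε).wexc = ∏ i, ((if π i < i then (if ε i = -1 then x else 1) else 1) *
      (if i < π.symm i then 1 else (if ε i = 1 then x else 1))) := by
  have h : (signedOf π ε).wexc =
      (Finset.univ.filter fun j => if π j < j then ε j = -1 else ε (π j) = 1).card := by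
    refine Finset.card_bij (fun i _ => π i) ?_ ?_ ?_
    · intro i hi
      simpa [isWeakExc_signedOf] using hi
    · simp
    · intro j hj
      exact ⟨π.symm j, by simpa [isWeakExc_signedOf] using hj, by simp⟩
  have h2 : ∏ i, (if i < π.symm i then 1 else (if ε i = 1 then x else 1))
      = ∏ j, (if π j < j then 1 else (if ε (π j) = 1 then x else 1)) :=
    (Equiv.prod_comp π _).symm.trans (by simp)
  rw [h, Finset.prod_mul_distrib, h2, ← Finset.prod_mul_distrib, ← Finset.prod_const,
    Finset.prod_filter]
  refine Finset.prod_congr rfl fun j _ => ?_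
  by_cases hj : π j < j <;> simp [hj]

theorem sum_pow_wexc_signedOf {R : Type*} [CommRing R] (x : R) {n : ℕ} (π : Perm (Fin n)) :
    ∑ ε : Fin n → ℤˣ, x ^ (signedOf π ε).wexc = (4 * x) ^ cpk π * (1 + x) ^ (n - 2 * cpk π) := by
  simp_rw [pow_wexc_signedOf]
  rw [← Fintype.prod_sum (fun i (δ : ℤˣ) => (if π i < i then (if δ = -1 then x else 1) else 1) *
      (if i < π.symm i then 1 else (if δ = 1 then x else 1)))]
  have hfix : ∀ i, π.symm i = i ↔ π i = i := fun i => by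
    rw [symm_apply_eq, eq_comm]
  have hterm : ∀ i, ∑ δ : ℤˣ, ((if π i < i then (if δ = -1 then x else 1) else 1) *
      (if i < π.symm i then 1 else (if δ = 1 then x else 1))) =
      -- A peak decides two comparisons in opposite senses, hence gives `x` for either sign; a
      -- valley decides none; any other element decides exactly one.
      if π.symm i < i ∧ i > π i then 2 * x else if IsValley π i then 2 else 1 + x := by
    intro i
    have hu : (Finset.univ : Finset ℤˣ) = {1, -1} := rfl
    have h11 : (1 : ℤˣ) ≠ -1 := by decide
    have h := hfix i
    rw [hu, Finset.sum_pair h11]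
    simp only [h11, h11.symm, if_true, if_false]
    split_ifs <;> first | ring1 | (exfalso; grind [IsValley])
  rw [Finset.prod_congr rfl fun i _ => hterm i, Finset.prod_ite, Finset.prod_ite,
    Finset.prod_const, Finset.prod_const, Finset.prod_const, Finset.filter_filter,
    Finset.filter_filter]
  set P := Finset.univ.filter fun i => π.symm i < i ∧ i > π i with hP
  have h1 : (Finset.univ.filter fun i => ¬ (π.symm i < i ∧ i > π i) ∧ IsValley π i)
      = Finset.univ.filter (IsValley π) := by
    refine Finset.filter_congr fun i _ => ⟨fun h => h.2, fun h => ⟨fun h' => ?_, h⟩⟩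
    exact lt_asymm h.1 h'.1
  have hPc : P.card = cpk π := rfl
  have h2 : (Finset.univ.filter fun i => ¬ (π.symm i < i ∧ i > π i) ∧ ¬ IsValley π i).card
      = n - 2 * cpk π := by
    have ha := Finset.card_filter_add_card_filter_not (s := (Finset.univ : Finset (Fin n)))
      (fun i => π.symm i < i ∧ i > π i)
    have hb := Finset.card_filter_add_card_filter_not
      (s := Finset.univ.filter fun i => ¬ (π.symm i < i ∧ i > π i)) (IsValley π)
    rw [Finset.filter_filter, Finset.filter_filter, h1, ← cpk_eq_card_valleys] at hb
    rw [← hP, hPc, Finset.card_univ, Fintype.card_fin] at ha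
    omega
  rw [h1, h2, hPc, ← cpk_eq_card_valleys, ← mul_assoc, ← mul_pow]
  congr 2
  ring

theorem sum_signedPerm {R : Type*} [CommRing R] (x k : R) (n : ℕ) :
    ∑ w : SignedPerm n, x ^ w.wexc * k ^ (n - w.cyc) =
      ∑ π : Perm (Fin n), (4 * x) ^ cpk π * (1 + x) ^ (n - 2 * cpk π) * k ^ (n - cyc π) := by
  rw [← (signedPermEquiv n).sum_comp, Fintype.sum_prod_type]
  refine Finset.sum_congr rfl fun π _ => ?_
  rw [← sum_pow_wexc_signedOf, Finset.sum_mul]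
  refine Finset.sum_congr rfl fun ε _ => ?_
  change x ^ (signedOf π ε).wexc * k ^ (n - cyc (signedOf π ε).abs) = _
  rw [abs_signedOf]

/-! ### The two polynomial families, their recurrences and $\gamma$-positivity. -/

/-- The polynomial `b_n(x, q)` in `x`, for a fixed `q`. -/
noncomputable def peakPoly {R : Type*} [CommRing R] (q : R) (n : ℕ) : R[X] :=
  ∑ π : Perm (Fin n), X ^ cpk π * C (q ^ (n - cyc π))

/-- The polynomial `B_n^{(k)}(x)`. -/
noncomputable def signedPoly {R : Type*} [CommRing R] (k : R) (n : ℕ) : R[X] :=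
  ∑ w : SignedPerm n, X ^ w.wexc * C (k ^ (n - w.cyc))

theorem signedPoly_eq {R : Type*} [CommRing R] (k : R) (n : ℕ) :
    signedPoly k n =
      ∑ π : Perm (Fin n), (4 * X) ^ cpk π * (1 + X) ^ (n - 2 * cpk π) * C (k ^ (n - cyc π)) := by
  simp_rw [C_pow]
  rw [← sum_signedPerm]
  simp_rw [signedPoly, C_pow]

theorem peakPoly_zero {R : Type*} [CommRing R] (q : R) : peakPoly q 0 = 1 := by
  simp [peakPoly, cpk_of_fin_zero, Finset.univ_unique]

theorem signedPoly_zero {R : Type*} [CommRing R] (k : R) : signedPoly k 0 = 1 := by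
  simp [signedPoly_eq, cpk_of_fin_zero, Finset.univ_unique]

theorem peakPoly_succ {R : Type*} [CommRing R] (q : R) (n : ℕ) :
    peakPoly q (n + 1) = (1 + C (n * q) * X) * peakPoly q n
      + C (2 * q) * X * (1 - X) * derivative (peakPoly q n) := by
  rw [peakPoly, sum_perm_succ (fun c m => (X ^ c * C (q ^ m) : R[X])), peakPoly, derivative_sum,
    Finset.mul_sum, Finset.mul_sum, ← Finset.sum_add_distrib]
  refine Finset.sum_congr rfl fun π _ => ?_
  obtain ⟨d, hd⟩ := Nat.exists_eq_add_of_le (two_mul_cpk_le π)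
  have hd' : n - 2 * cpk π = d := by omega
  have hn : (n : R[X]) = 2 * (cpk π : R[X]) + d := by
    exact_mod_cast congrArg (Nat.cast (R := R[X])) hd
  rw [hd']
  have hC : C (n * q) = (n : R[X]) * C q := by simp
  have hC2 : C (2 * q) = (2 : R[X]) * C q := by rw [C_mul, map_ofNat]
  rw [derivative_mul, derivative_C, mul_zero, add_zero, derivative_X_pow, hC, hC2, hn]
  simp only [nsmul_eq_mul, pow_succ, C_mul, map_natCast]
  generalize C (q ^ (n - cyc π)) = m
  cases h : cpk π with
  | zero => push_cast; ring
  | succ c => push_cast; ring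

theorem signedPoly_succ {R : Type*} [CommRing R] (k : R) (n : ℕ) :
    signedPoly k (n + 1) = (1 + X + C (2 * k * n) * X) * signedPoly k n
      + C (2 * k) * X * (1 - X) * derivative (signedPoly k n) := by
  rw [signedPoly_eq, sum_perm_succ (fun c m => ((4 * X) ^ c * (1 + X) ^ (n + 1 - 2 * c)
    * C (k ^ m) : R[X])), signedPoly_eq, derivative_sum,
    Finset.mul_sum, Finset.mul_sum, ← Finset.sum_add_distrib]
  refine Finset.sum_congr rfl fun π _ => ?_
  obtain ⟨d, hd⟩ := Nat.exists_eq_add_of_le (two_mul_cpk_le π)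
  have hd1 : n - 2 * cpk π = d := by omega
  have hd2 : n + 1 - 2 * cpk π = d + 1 := by omega
  -- The truncation at `d = 0` is harmless: this exponent occurs only in a term of multiplicity `d`.
  have hd3 : n + 1 - 2 * (cpk π + 1) = d - 1 := by omega
  have hn : (n : R[X]) = 2 * (cpk π : R[X]) + d := by
    exact_mod_cast congrArg (Nat.cast (R := R[X])) hd
  rw [hd1, hd2, hd3]
  have hC : C (2 * k * n) = (2 : R[X]) * C k * (n : R[X]) := by
    rw [C_mul, C_mul, map_ofNat, map_natCast]
  have hC2 : C (2 * k) = (2 : R[X]) * C k := by rw [C_mul, map_ofNat]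
  have hder : ∀ j : ℕ, derivative ((1 + X : R[X]) ^ j) = (j : R[X]) * (1 + X) ^ (j - 1) := by
    intro j
    simp [derivative_pow]
  have hder4 : ∀ j : ℕ, derivative ((4 * X : R[X]) ^ j) = (j : R[X]) * (4 * X) ^ (j - 1) * 4 := by
    intro j
    have h4 : (4 * X : R[X]) = C 4 * X := by rw [map_ofNat]
    rw [derivative_pow, h4, derivative_C_mul_X]
    simp [map_ofNat C 4]
  rw [derivative_mul, derivative_C, mul_zero, add_zero, derivative_mul, hder, hder4, hC, hC2, hn]
  simp only [nsmul_eq_mul, pow_succ, C_mul]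
  generalize C (k ^ (n - cyc π)) = m
  cases h : cpk π <;> cases d <;> push_cast <;> ring

theorem signedPoly_one {R : Type*} [CommRing R] (k : R) : signedPoly k 1 = 1 + X := by
  rw [signedPoly_succ, signedPoly_zero]
  simp

theorem signedPoly_eq_sum_b (k : ℝ) {n : ℕ} (hn : 1 ≤ n) :
    signedPoly k n = ∑ i ∈ Finset.range (n / 2 + 1),
      C (∑ j ∈ Finset.Icc i (n - 1), (b n i j : ℝ) * k ^ j * 4 ^ i)
        * X ^ i * (1 + X) ^ (n - 2 * i) := by
  rw [signedPoly_eq, sum_perm_eq_sum_b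
    (fun i j => ((4 * X) ^ i * (1 + X) ^ (n - 2 * i) * C (k ^ j) : ℝ[X])) hn]
  refine Finset.sum_congr rfl fun i _ => ?_
  rw [map_sum, Finset.sum_mul, Finset.sum_mul]
  refine Finset.sum_congr rfl fun j _ => ?_
  have h4 : (C 4 : ℝ[X]) = 4 := map_ofNat C 4
  simp only [zsmul_eq_mul, C_mul, C_pow, mul_pow, h4, map_intCast]
  ring

theorem isGammaPositive_of_eq_sum {n : ℕ} {f : ℝ[X]} (γ : ℕ → ℝ) (hγ : ∀ i ≤ n / 2, 0 ≤ γ i)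
    (hf : f = ∑ i ∈ Finset.range (n / 2 + 1), C (γ i) * X ^ i * (1 + X) ^ (n - 2 * i)) :
    IsGammaPositive n f := by
  refine ⟨?_, ?_, γ, hγ, hf⟩
  · rw [hf]
    refine natDegree_sum_le_of_forall_le _ _ fun i hi => ?_
    rw [Finset.mem_range] at hi
    have h1 : (1 + X : ℝ[X]).natDegree ≤ 1 := by
      rw [add_comm]; exact natDegree_X_add_C (1 : ℝ) |>.le
    have h2 : ((1 + X : ℝ[X]) ^ (n - 2 * i)).natDegree ≤ n - 2 * i := by
      simpa using natDegree_pow_le_of_le (n - 2 * i) h1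
    refine (natDegree_mul_le_of_le (natDegree_C_mul_X_pow_le (γ i) i) h2).trans ?_
    omega
  · intro m hm
    rw [hf, finsetSum_coeff, finsetSum_coeff]
    refine Finset.sum_congr rfl fun i hi => ?_
    rw [Finset.mem_range] at hi
    have hc : ∀ l, (C (γ i) * X ^ i * (1 + X) ^ (n - 2 * i)).coeff l
        = if i ≤ l then γ i * ((n - 2 * i).choose (l - i) : ℝ) else 0 := by
      intro l
      rw [mul_assoc, coeff_C_mul, coeff_X_pow_mul']
      split_ifs
      · rw [coeff_one_add_X_pow]
      · rw [mul_zero]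
    rw [hc, hc]
    by_cases h1 : i ≤ m <;> by_cases h2 : i ≤ n - m
    · have h : n - 2 * i = (m - i) + (n - m - i) := by omega
      rw [if_pos h1, if_pos h2, Nat.choose_symm_of_eq_add h]
    · rw [if_pos h1, if_neg h2, Nat.choose_eq_zero_of_lt (by omega)]
      simp
    · rw [if_neg h1, if_pos h2, Nat.choose_eq_zero_of_lt (by omega)]
      simp
    · rw [if_neg h1, if_neg h2]

theorem sum_b_nonneg {k : ℝ} (hk : 0 < k) (n i : ℕ) :
    0 ≤ ∑ j ∈ Finset.Icc i (n - 1), (b n i j : ℝ) * k ^ j * 4 ^ i :=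
  Finset.sum_nonneg fun j _ => by
    have : (0 : ℝ) ≤ b n i j := by exact_mod_cast b_nonneg n i j
    positivity

theorem aeval_bPoly (x q : ℂ) (n : ℕ) :
    MvPolynomial.aeval ![x, q] (bPoly n) = (peakPoly q n).eval x := by
  rw [bPoly_eq_sum, peakPoly, eval_finsetSum, map_sum]
  simp

theorem aeval_signedPoly (x : ℂ) (k : ℝ) (n : ℕ) :
    aeval x (signedPoly k n) = (signedPoly (k : ℂ) n).eval x := by
  rw [signedPoly, signedPoly, eval_finsetSum, map_sum]
  simp

end CycleStatistics

/-! ### Exponential generating functions. -/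

/-- If `F' = F r α(u)`, `r' = r² β(u)` and `u' = r γ(u)` near `0`, then the `n`-th derivative of `F`
is `F rⁿ P_n(u)`, where `P_{n+1} = (α + n β) P_n + γ P_n'`. -/
theorem iteratedDeriv_eventuallyEq {F r u : ℂ → ℂ} {α β γ : ℂ[X]} {P : ℕ → ℂ[X]}
    (hP0 : P 0 = 1)
    (hP : ∀ n, P (n + 1) = (α + (n : ℂ[X]) * β) * P n + γ * derivative (P n))
    (hF : ∀ᶠ z in 𝓝 (0 : ℂ), HasDerivAt F (F z * r z * α.eval (u z)) z)
    (hr : ∀ᶠ z in 𝓝 (0 : ℂ), HasDerivAt r (r z ^ 2 * β.eval (u z)) z)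
    (hu : ∀ᶠ z in 𝓝 (0 : ℂ), HasDerivAt u (r z * γ.eval (u z)) z) (n : ℕ) :
    ∀ᶠ z in 𝓝 (0 : ℂ), iteratedDeriv n F z = F z * r z ^ n * (P n).eval (u z) := by
  induction n with
  | zero => simp [hP0]
  | succ n ih =>
    filter_upwards [ih.eventually_nhds, hF, hr, hu] with z h hF hr hu
    rw [iteratedDeriv_succ, Filter.EventuallyEq.deriv_eq h]
    have hPu : HasDerivAt (fun z => (P n).eval (u z))
        ((derivative (P n)).eval (u z) * (r z * γ.eval (u z))) z :=
      ((P n).hasDerivAt (u z)).comp z hu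
    rw [((hF.fun_mul (hr.fun_pow n)).fun_mul hPu).deriv, hP]
    simp only [eval_add, eval_mul, eval_natCast]
    cases n with
    | zero => simp; ring
    | succ n => simp only [Nat.add_sub_cancel]; push_cast; ring

theorem hasSum_of_derivatives {F r u : ℂ → ℂ} {α β γ : ℂ[X]} {P : ℕ → ℂ[X]} (hP0 : P 0 = 1)
    (hP : ∀ n, P (n + 1) = (α + (n : ℂ[X]) * β) * P n + γ * derivative (P n))
    (hF : ∀ᶠ z in 𝓝 (0 : ℂ), HasDerivAt F (F z * r z * α.eval (u z)) z)
    (hr : ∀ᶠ z in 𝓝 (0 : ℂ), HasDerivAt r (r z ^ 2 * β.eval (u z)) z)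
    (hu : ∀ᶠ z in 𝓝 (0 : ℂ), HasDerivAt u (r z * γ.eval (u z)) z)
    (hF0 : F 0 = 1) (hr0 : r 0 = 1) :
    ∀ᶠ z in 𝓝 (0 : ℂ),
      HasSum (fun n : ℕ => (P n).eval (u 0) * z ^ n / (n.factorial : ℂ)) (F z) := by
  have hA : AnalyticAt ℂ F 0 := by
    rw [Complex.analyticAt_iff_eventually_differentiableAt]
    exact hF.mono fun z h => h.differentiableAt
  filter_upwards [hasFPowerSeriesAt_iff.1 hA.hasFPowerSeriesAt] with z hz
  rw [zero_add] at hz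
  refine hz.congr_fun fun n => ?_
  rw [FormalMultilinearSeries.coeff_ofScalars, smul_eq_mul,
    (iteratedDeriv_eventuallyEq hP0 hP hF hr hu n).self_of_nhds, hF0, hr0]
  ring

theorem coeff_eq_of_hasSum {a c : ℕ → ℂ} {f : ℂ → ℂ}
    (ha : ∀ᶠ z in 𝓝 (0 : ℂ), HasSum (fun n : ℕ => a n * z ^ n / (n.factorial : ℂ)) (f z))
    (hc : ∀ᶠ z in 𝓝 (0 : ℂ), HasSum (fun n : ℕ => c n * z ^ n / (n.factorial : ℂ)) (f z)) :
    a = c := by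
  have key : ∀ d : ℕ → ℂ,
      (∀ᶠ z in 𝓝 (0 : ℂ), HasSum (fun n : ℕ => d n * z ^ n / (n.factorial : ℂ)) (f z)) →
      HasFPowerSeriesAt f
        (FormalMultilinearSeries.ofScalars ℂ fun n => d n / (n.factorial : ℂ)) 0 := by
    intro d hd
    rw [hasFPowerSeriesAt_iff]
    filter_upwards [hd] with z hz
    rw [zero_add]
    refine hz.congr_fun fun n => ?_
    rw [FormalMultilinearSeries.coeff_ofScalars, smul_eq_mul]
    ring
  have h := (key a ha).eq_formalMultilinearSeries (key c hc)
  funext n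
  have hn := congrArg (fun p => FormalMultilinearSeries.coeff p n) h
  simp only [FormalMultilinearSeries.coeff_ofScalars] at hn
  have : (n.factorial : ℂ) ≠ 0 := by exact_mod_cast n.factorial_ne_zero
  rwa [div_left_inj' this] at hn

theorem isEulerianB_unique {k : ℝ} {A B : ℕ → ℝ[X]} (hA : IsEulerianB k A)
    (hB : IsEulerianB k B) : A = B := by
  funext n
  apply eq_of_infinite_eval_eq
  refine Set.Infinite.mono ?_ (Set.Ioi_infinite (1 : ℝ))
  intro x hx
  have hx1 : (x : ℂ) ≠ 1 := by
    exact_mod_cast (ne_of_gt hx)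
  have h := congrFun (coeff_eq_of_hasSum (hA x hx1) (hB x hx1)) n
  have ha : ∀ p : ℝ[X], aeval (x : ℂ) p = ((p.eval x : ℝ) : ℂ) := fun p => by
    rw [← Complex.coe_algebraMap, aeval_algebraMap_apply, coe_aeval_eq_eval]
  rw [ha, ha] at h
  exact_mod_cast h

theorem isEulerianB_signedPoly {k : ℝ} (hk : k ≠ 0) : IsEulerianB k (signedPoly k) := by
  intro x hx
  have hx' : 1 - x ≠ 0 := sub_ne_zero.2 hx.symm
  have hkc : (k : ℂ) ≠ 0 := by exact_mod_cast hk
  simp_rw [aeval_signedPoly]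
  -- Translation in $z$ explains the choice of $u$ and $r=(1-x)/(1-u)$: writing $F(x;z)$ for the
  -- closed form, formally $F(x;z+h)=F(x;z)\,F(u(z);r(z)h)$.
  set u : ℂ → ℂ := fun z => x * Complex.exp (2 * k * z * (1 - x)) with hudef
  set G : ℂ → ℂ := fun z => (1 - x) * Complex.exp (k * z * (1 - x)) / (1 - u z) with hGdef
  have hu0 : u 0 = x := by simp [hudef]
  have hG0 : G 0 = 1 := by simp [hGdef, hu0, hx']
  have hu : ∀ z, HasDerivAt u (2 * k * (1 - x) * u z) z := by
    intro z
    have h1 : HasDerivAt (fun z : ℂ => 2 * k * z * (1 - x)) (2 * k * (1 - x)) z := by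
      simpa using ((hasDerivAt_id z).const_mul (2 * k : ℂ)).mul_const (1 - x)
    refine HasDerivAt.congr_deriv ((h1.cexp.const_mul x)) ?_
    rw [hudef]
    ring
  have hune : ∀ᶠ z in 𝓝 (0 : ℂ), 1 - u z ≠ 0 := by
    have hc : ContinuousAt (fun z => 1 - u z) 0 := (hu 0).continuousAt.const_sub 1
    exact hc.eventually_ne (by rwa [hu0])
  have hG : ∀ᶠ z in 𝓝 (0 : ℂ),
      HasDerivAt G (k * (G z * ((1 - x) / (1 - u z)) * (1 + u z))) z := by
    filter_upwards [hune] with z hz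
    have h1 : HasDerivAt (fun z : ℂ => k * z * (1 - x)) (k * (1 - x)) z := by
      simpa using ((hasDerivAt_id z).const_mul (k : ℂ)).mul_const (1 - x)
    refine HasDerivAt.congr_deriv ((h1.cexp.const_mul (1 - x)).fun_div ((hu z).const_sub 1) hz) ?_
    rw [hGdef]
    field_simp
    ring
  have hslit : ∀ᶠ z in 𝓝 (0 : ℂ), G z ∈ Complex.slitPlane := by
    have hc : ContinuousAt G 0 := hG.self_of_nhds.continuousAt
    exact hc.eventually_mem (Complex.isOpen_slitPlane.mem_nhds (by simp [hG0]))
  have := hasSum_of_derivatives (F := fun z => G z ^ (1 / (k : ℂ)))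
    (r := fun z => (1 - x) / (1 - u z)) (u := u) (α := 1 + X) (β := C (2 * (k : ℂ)) * X)
    (γ := C (2 * (k : ℂ)) * X * (1 - X)) (P := signedPoly (k : ℂ)) (signedPoly_zero _)
    (fun n => by
      rw [signedPoly_succ, C_mul (b := (n : ℂ)), map_natCast]
      ring) ?_ ?_ ?_ ?_ ?_
  · rw [hu0] at this
    exact this
  · filter_upwards [hG, hslit] with z h1 h2
    have h0 : G z ≠ 0 := Complex.slitPlane_ne_zero h2
    refine HasDerivAt.congr_deriv (h1.cpow_const h2) ?_
    rw [Complex.cpow_sub _ _ h0, Complex.cpow_one]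
    simp only [eval_add, eval_one, eval_X]
    field_simp
  · filter_upwards [hune] with z hz
    refine HasDerivAt.congr_deriv ((hasDerivAt_const z (1 - x)).fun_div ((hu z).const_sub 1) hz) ?_
    simp only [eval_mul, eval_C, eval_X]
    field_simp
    ring
  · filter_upwards [hune] with z hz
    refine HasDerivAt.congr_deriv (hu z) ?_
    simp only [eval_mul, eval_C, eval_X, eval_sub, eval_one]
    field_simp
  · simp [hG0]
  · simp [hu0, hx']

theorem hasSum_peakPoly {x q s : ℂ} (hx : x ≠ 1) (hq : q ≠ 0) (hs : s ^ 2 = 1 - x) :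
    ∀ᶠ z : ℂ in 𝓝 0, HasSum (fun n : ℕ => (peakPoly q n).eval x * z ^ n / (n.factorial : ℂ))
      ((s / (s * Complex.cosh (q * z * s) - Complex.sinh (q * z * s))) ^ (1 / q)) := by
  have hs0 : s ≠ 0 := by
    rintro rfl
    exact hx (by linear_combination hs)
  set D : ℂ → ℂ := fun z => s * Complex.cosh (q * z * s) - Complex.sinh (q * z * s) with hD
  -- $D'=-qsE$ and $E'=-qsD$, so the logarithmic derivative of $(s/D)^{1/q}$ is $r=sE/D$. Then
  -- $r'=qr^2(1-D^2/E^2)$ dictates $u=1-D^2/E^2$, and $u(0)=1-s^2=x$.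
  set E : ℂ → ℂ := fun z => Complex.cosh (q * z * s) - s * Complex.sinh (q * z * s) with hE
  have hlin : ∀ z : ℂ, HasDerivAt (fun z : ℂ => q * z * s) (q * s) z := fun z => by
    simpa using ((hasDerivAt_id z).const_mul q).mul_const s
  have hDd : ∀ z, HasDerivAt D (-(q * s * E z)) z := fun z => by
    refine HasDerivAt.congr_deriv (((hlin z).ccosh.const_mul s).fun_sub (hlin z).csinh) ?_
    rw [hE]
    ring
  have hEd : ∀ z, HasDerivAt E (-(q * s * D z)) z := fun z => by
    refine HasDerivAt.congr_deriv ((hlin z).ccosh.fun_sub ((hlin z).csinh.const_mul s)) ?_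
    rw [hD]
    ring
  have hD0 : D 0 = s := by simp [hD]
  have hE0 : E 0 = 1 := by simp [hE]
  have hDne : ∀ᶠ z in 𝓝 (0 : ℂ), D z ≠ 0 :=
    (hDd 0).continuousAt.eventually_ne (by rwa [hD0])
  have hEne : ∀ᶠ z in 𝓝 (0 : ℂ), E z ≠ 0 :=
    (hEd 0).continuousAt.eventually_ne (by simp [hE0])
  have hslit : ∀ᶠ z in 𝓝 (0 : ℂ), s / D z ∈ Complex.slitPlane := by
    have hc : ContinuousAt (fun z => s / D z) 0 :=
      continuousAt_const.div (hDd 0).continuousAt (by rwa [hD0])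
    exact hc.eventually_mem (Complex.isOpen_slitPlane.mem_nhds (by simp [hD0, hs0]))
  have := hasSum_of_derivatives (F := fun z => (s / D z) ^ (1 / q))
    (r := fun z => s * E z / D z) (u := fun z => 1 - D z ^ 2 / E z ^ 2) (α := 1) (β := C q * X)
    (γ := C (2 * q) * X * (1 - X)) (P := peakPoly q) (peakPoly_zero _)
    (fun n => by
      rw [peakPoly_succ, C_mul (a := (n : ℂ)), map_natCast]
      ring) ?_ ?_ ?_ ?_ ?_
  · have hu0 : 1 - D 0 ^ 2 / E 0 ^ 2 = x := by
      rw [hD0, hE0]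
      linear_combination -hs
    rw [hu0] at this
    exact this
  · filter_upwards [hDne, hslit] with z hz h2
    have h0 : s / D z ≠ 0 := Complex.slitPlane_ne_zero h2
    refine HasDerivAt.congr_deriv (((hasDerivAt_const z s).fun_div (hDd z) hz).cpow_const h2) ?_
    rw [Complex.cpow_sub _ _ h0, Complex.cpow_one]
    simp only [eval_one]
    field_simp
    ring
  · filter_upwards [hDne, hEne] with z hz hz'
    refine HasDerivAt.congr_deriv (((hEd z).const_mul s).fun_div (hDd z) hz) ?_
    simp only [eval_mul, eval_C, eval_X]
    field_simp
    ring
  · filter_upwards [hDne, hEne] with z hz hz'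
    refine HasDerivAt.congr_deriv
      ((((hDd z).fun_pow 2).fun_div ((hEd z).fun_pow 2) (pow_ne_zero 2 hz')).const_sub 1) ?_
    simp only [eval_mul, eval_C, eval_X, eval_sub, eval_one]
    field_simp
    ring
  · simp [hD0, hs0]
  · simp [hD0, hE0, hs0]

end TypeB

theorem theorem1 :
    -- the polynomials `B_n^{(k)}`
    (∀ k : ℝ, k ≠ 0 →
      (∃! B : ℕ → ℝ[X], TypeB.IsEulerianB k B) ∧
      ∀ B : ℕ → ℝ[X], TypeB.IsEulerianB k B →
        (∀ n : ℕ, B n = ∑ w : TypeB.SignedPerm n, X ^ w.wexc * C (k ^ (n - w.cyc))) ∧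
        B 0 = 1 ∧ B 1 = 1 + X ∧
        (∀ n : ℕ, B (n + 1) = (1 + X + C (2 * k * n) * X) * B n
          + C (2 * k) * X * (1 - X) * derivative (B n)) ∧
        (∀ n : ℕ, 1 ≤ n → B n = ∑ i ∈ Finset.range (n / 2 + 1),
          C (∑ j ∈ Finset.Icc i (n - 1), (TypeB.b n i j : ℝ) * k ^ j * 4 ^ i)
            * X ^ i * (1 + X) ^ (n - 2 * i)) ∧
        (0 < k → ∀ n : ℕ, 1 ≤ n →
          TypeB.IsGammaPositive n (B n) ∧
          ∀ i ≤ n / 2, 0 ≤ ∑ j ∈ Finset.Icc i (n - 1), (TypeB.b n i j : ℝ) * k ^ j * 4 ^ i)) ∧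
    -- the polynomials `b_n(x, q)`
    (∀ n : ℕ, TypeB.bPoly n = ∑ π : Equiv.Perm (Fin n),
      MvPolynomial.X 0 ^ TypeB.cpk π * MvPolynomial.X 1 ^ (n - TypeB.cyc π)) ∧
    -- their generating function, with `s` either one of the square roots of `1 - x`
    (∀ x q s : ℂ, x ≠ 1 → q ≠ 0 → s ^ 2 = 1 - x → ∀ᶠ z : ℂ in 𝓝 0,
      HasSum (fun n : ℕ => MvPolynomial.aeval ![x, q] (TypeB.bPoly n) * z ^ n / (n.factorial : ℂ))
        ((s / (s * Complex.cosh (q * z * s) - Complex.sinh (q * z * s))) ^ (1 / q))) := by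
  refine ⟨fun k hk => ⟨⟨TypeB.signedPoly k, TypeB.isEulerianB_signedPoly hk, fun A hA =>
    TypeB.isEulerianB_unique hA (TypeB.isEulerianB_signedPoly hk)⟩, fun B hB => ?_⟩,
    TypeB.bPoly_eq_sum, fun x q s hx hq hs => ?_⟩
  · obtain rfl := TypeB.isEulerianB_unique hB (TypeB.isEulerianB_signedPoly hk)
    exact ⟨fun n => rfl, TypeB.signedPoly_zero k, TypeB.signedPoly_one k, TypeB.signedPoly_succ k,
      fun n hn => TypeB.signedPoly_eq_sum_b k hn, fun hk0 n hn =>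
        ⟨TypeB.isGammaPositive_of_eq_sum _ (fun i _ => TypeB.sum_b_nonneg hk0 n i)
          (TypeB.signedPoly_eq_sum_b k hn), fun i _ => TypeB.sum_b_nonneg hk0 n i⟩⟩
  · simp_rw [TypeB.aeval_bPoly]
    exact TypeB.hasSum_peakPoly hx hq hs
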